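/- Fix a set $\mathcal R$ of roles (possibly infinite); role sets are subsets of $\mathcal R$, and $\overline R=\mathcal R\setminus R$. Fix a first-order language with its terms $t$. The formulas of linear multirole logic (LMRL) are $$A,B ::= a \mid \neg_f A \mid A\otimes_{\mathcal U}B \mid A\,\&_{\mathcal U}B \mid\; !_{\mathcal U}A \mid \forall_{\mathcal U}(\lambda x.A),$$ where $a$ ranges over atomic formulas $P(t_1,\dots,t_k)$, $f$ over all maps $\mathcal R\to\mathcal R$, and $\mathcal U$ over all ultrafilters on $\mathcal R$; formulas are taken up to renaming of bound variables. An i-formula $[R]A$ is a formula $A$ together with a role set $R$; a sequent $\Gamma$ is a finite multiset of i-formulas. We write $?(\Gamma)$ for a sequent in which each i-formula has the form $[R]\,!_{\mathcal U}A$ with $R\notin\mathcal U$. The derivable sequents are those generated by the following rules (premises $\Rightarrow$ conclusion). - (Id) $\Rightarrow [R_1]a,\dots,[R_n]a$, if $\mathcal R=R_1\uplus\dots\uplus R_n$ (a disjoint union; some $R_i$ may be empty). - ($\neg$) $\Gamma,[f^{-1}(R)]A \Rightarrow \Gamma,[R]\neg_fA$. - ($\&$-neg) if $R\notin\mathcal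 U$: $\Gamma,[R]A\Rightarrow\Gamma,[R](A\,\&_{\mathcal U}B)$, and $\Gamma,[R]B\Rightarrow\Gamma,[R](A\,\&_{\mathcal U}B)$. - ($\&$-pos) if $R\in\mathcal U$: $(\Gamma,[R]A;\ \Gamma,[R]B)\Rightarrow\Gamma,[R](A\,\&_{\mathcal U}B)$. - ($\otimes$-neg) if $R\notin\mathcal U$: $\Gamma,[R]A,[R]B\Rightarrow\Gamma,[R](A\otimes_{\mathcal U}B)$. - ($\otimes$-pos) if $R\in\mathcal U$: $(\Gamma_1,[R]A;\ \Gamma_2,[R]B)\Rightarrow\Gamma_1,\Gamma_2,[R](A\otimes_{\mathcal U}B)$. - ($!$-pos) if $R\in\mathcal U$: $?(\Gamma),[R]A\Rightarrow\ ?(\Gamma),[R]\,!_{\mathcal U}A$. - ($!$-neg) if $R\notin\mathcal U$: weakening $\Gamma\Rightarrow\Gamma,[R]\,!_{\mathcal U}A$; dereliction $\Gamma,[R]A\Rightarrow\Gamma,[R]\,!_{\mathcal U}A$; contraction $\Gamma,[R]\,!_{\mathcal U}A,[R]\,!_{\mathcal U}A\Rightarrow\Gamma,[R]\,!_{\mathcal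 U}A$. - ($\forall$-neg) if $R\notin\mathcal U$: $\Gamma,[R]A[t/x]\Rightarrow\Gamma,[R]\forall_{\mathcal U}(\lambda x.A)$, for any term $t$. - ($\forall$-pos) if $R\in\mathcal U$ and $x$ is not free in $\Gamma$: $\Gamma,[R]A\Rightarrow\Gamma,[R]\forall_{\mathcal U}(\lambda x.A)$. Let $A$ be a formula. Then the following hold. 1. (mp-cut) Let $n\ge1$ and let $R_1,\dots,R_n\subseteq\mathcal R$ satisfy $\overline{R_1}\uplus\dots\uplus\overline{R_n}=\mathcal R$, that is, the $\overline{R_i}$ are pairwise disjoint (for different indices) with union $\mathcal R$. If $\Gamma_i,[R_i]A$ is derivable for every $1\le i\le n$, then $\Gamma_1,\dots,\Gamma_n$ is derivable. 2. (2-cut with residual) Let $R_1,R_2\subseteq\mathcal R$ be such that $\overline{R_1}$ and $\overline{R_2}$ are disjoint. If $\Gamma_1,[R_1]A$ and $\Gamma_2,[R_2]A$ are derivable, then $\Gamma_1,\Gamma_2,[R_1\cap R_2]A$ is derivable. -/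

import Mathlib

universe u v w

namespace LMRL

/-- `R₁ ⊎ ⋯ ⊎ Rₙ` is the full set of roles. Some of the `Rᵢ` may be empty, and disjointness is
required between different indices. -/
def IsRolePartition {Role : Type w} {n : ℕ} (R : Fin n → Set Role) : Prop :=
  (∀ i j, i ≠ j → Disjoint (R i) (R j)) ∧ (⋃ i, R i) = Set.univ

/-- Formulas of linear multirole logic over a first-order language `L` and a set `Role` of roles,
in de Bruijn style: variables are natural numbers, and `all U A` binds the variable `0` of `A`,
the variable `k + 1` of `A` being the variable `k` of `all U A`. Thus formulas are taken up to
renaming of bound variables. -/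
inductive Formula (L : FirstOrder.Language.{u, v}) (Role : Type w) : Type (max u v w)
  /-- A primitive formula `P(t₁, …, tₖ)`. -/
  | atom {k : ℕ} (P : L.Relations k) (ts : Fin k → L.Term ℕ) : Formula L Role
  /-- `¬_f A`, for an arbitrary endomorphism `f` of the set of roles. -/
  | neg (f : Role → Role) (A : Formula L Role) : Formula L Role
  /-- The multiplicative `A ⊗_U B`. -/
  | tensor (U : Ultrafilter Role) (A B : Formula L Role) : Formula L Role
  /-- The additive `A &_U B`. -/
  | amp (U : Ultrafilter Role) (A B : Formula L Role) : Formula L Role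
  /-- The exponential `!_U A`. -/
  | bang (U : Ultrafilter Role) (A : Formula L Role) : Formula L Role
  /-- The quantifier `∀_U (λ x. A)`. -/
  | all (U : Ultrafilter Role) (A : Formula L Role) : Formula L Role

/-- The extension of a substitution under one binder. -/
def liftSubst {L : FirstOrder.Language.{u, v}} (s : ℕ → L.Term ℕ) : ℕ → L.Term ℕ
  | 0 => FirstOrder.Language.Term.var 0
  | k + 1 => (s k).relabel Nat.succ

namespace Formula

variable {L : FirstOrder.Language.{u, v}} {Role : Type w}

/-- Simultaneous capture-avoiding substitution of terms for the free variables. -/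
def subst : (ℕ → L.Term ℕ) → Formula L Role → Formula L Role
  | s, atom P ts => atom P (fun i => (ts i).subst s)
  | s, neg f A => neg f (subst s A)
  | s, tensor U A B => tensor U (subst s A) (subst s B)
  | s, amp U A B => amp U (subst s A) (subst s B)
  | s, bang U A => bang U (subst s A)
  | s, all U A => all U (subst (liftSubst s) A)

/-- Rename every free variable `k` to `k + 1`, so that the variable `0` becomes fresh. -/
def shift (A : Formula L Role) : Formula L Role :=
  A.subst (fun k => FirstOrder.Language.Term.var (k + 1))

/-- The body `A` of a quantified formula with the term `t` substituted for the variable `0` that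
the quantifier binds; the remaining free variables are renumbered accordingly. -/
def inst (A : Formula L Role) (t : L.Term ℕ) : Formula L Role :=
  A.subst (fun k => Nat.casesOn k t (fun j => FirstOrder.Language.Term.var j))

end Formula

/-- An i-formula `[R]A`: a formula `A` together with a set `R` of roles. -/
structure IFormula (L : FirstOrder.Language.{u, v}) (Role : Type w) : Type (max u v w) where
  roles : Set Role
  formula : Formula L Role

namespace IFormula

variable {L : FirstOrder.Language.{u, v}} {Role : Type w}

/-- The i-formula has the form `[R]?(A)`, that is, `[R]!_U A` with `R ∉ U`. -/
def IsWhyNot (F : IFormula L Role) : Prop :=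
  ∃ (U : Ultrafilter Role) (A : Formula L Role), F.formula = Formula.bang U A ∧ F.roles ∉ U

/-- Renaming of the free variables that makes the variable `0` fresh. -/
def shift (F : IFormula L Role) : IFormula L Role := ⟨F.roles, F.formula.shift⟩

end IFormula

/-- Sequents are finite multisets of i-formulas. -/
abbrev Sequent (L : FirstOrder.Language.{u, v}) (Role : Type w) : Type (max u v w) :=
  Multiset (IFormula L Role)

/-- Derivability in linear multirole logic. In the rule `all_pos` the eigenvariable is the variable
`0` of the premise: it is fresh for the side formulas because these are shifted. -/
inductive Derivable {L : FirstOrder.Language.{u, v}} {Role : Type w} : Sequent L Role → Prop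
  | id {n : ℕ} (R : Fin n → Set Role) (hR : IsRolePartition R)
      {k : ℕ} (P : L.Relations k) (ts : Fin k → L.Term ℕ) :
      Derivable (∑ i, {⟨R i, Formula.atom P ts⟩})
  | neg (Γ : Sequent L Role) (R : Set Role) (f : Role → Role) (A : Formula L Role) :
      Derivable (⟨f ⁻¹' R, A⟩ ::ₘ Γ) →
      Derivable (⟨R, Formula.neg f A⟩ ::ₘ Γ)
  | amp_neg_l (Γ : Sequent L Role) (R : Set Role) (U : Ultrafilter Role) (A B : Formula L Role) :
      R ∉ U → Derivable (⟨R, A⟩ ::ₘ Γ) →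
      Derivable (⟨R, Formula.amp U A B⟩ ::ₘ Γ)
  | amp_neg_r (Γ : Sequent L Role) (R : Set Role) (U : Ultrafilter Role) (A B : Formula L Role) :
      R ∉ U → Derivable (⟨R, B⟩ ::ₘ Γ) →
      Derivable (⟨R, Formula.amp U A B⟩ ::ₘ Γ)
  | amp_pos (Γ : Sequent L Role) (R : Set Role) (U : Ultrafilter Role) (A B : Formula L Role) :
      R ∈ U → Derivable (⟨R, A⟩ ::ₘ Γ) → Derivable (⟨R, B⟩ ::ₘ Γ) →
      Derivable (⟨R, Formula.amp U A B⟩ ::ₘ Γ)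
  | tensor_neg (Γ : Sequent L Role) (R : Set Role) (U : Ultrafilter Role) (A B : Formula L Role) :
      R ∉ U → Derivable (⟨R, A⟩ ::ₘ ⟨R, B⟩ ::ₘ Γ) →
      Derivable (⟨R, Formula.tensor U A B⟩ ::ₘ Γ)
  | tensor_pos (Γ₁ Γ₂ : Sequent L Role) (R : Set Role) (U : Ultrafilter Role)
      (A B : Formula L Role) :
      R ∈ U → Derivable (⟨R, A⟩ ::ₘ Γ₁) → Derivable (⟨R, B⟩ ::ₘ Γ₂) →
      Derivable (⟨R, Formula.tensor U A B⟩ ::ₘ (Γ₁ + Γ₂))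
  | bang_pos (Γ : Sequent L Role) (R : Set Role) (U : Ultrafilter Role) (A : Formula L Role) :
      R ∈ U → (∀ F ∈ Γ, F.IsWhyNot) → Derivable (⟨R, A⟩ ::ₘ Γ) →
      Derivable (⟨R, Formula.bang U A⟩ ::ₘ Γ)
  | bang_neg_weaken (Γ : Sequent L Role) (R : Set Role) (U : Ultrafilter Role)
      (A : Formula L Role) :
      R ∉ U → Derivable Γ →
      Derivable (⟨R, Formula.bang U A⟩ ::ₘ Γ)
  | bang_neg_derelict (Γ : Sequent L Role) (R : Set Role) (U : Ultrafilter Role)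
      (A : Formula L Role) :
      R ∉ U → Derivable (⟨R, A⟩ ::ₘ Γ) →
      Derivable (⟨R, Formula.bang U A⟩ ::ₘ Γ)
  | bang_neg_contract (Γ : Sequent L Role) (R : Set Role) (U : Ultrafilter Role)
      (A : Formula L Role) :
      R ∉ U → Derivable (⟨R, Formula.bang U A⟩ ::ₘ ⟨R, Formula.bang U A⟩ ::ₘ Γ) →
      Derivable (⟨R, Formula.bang U A⟩ ::ₘ Γ)
  | all_neg (Γ : Sequent L Role) (R : Set Role) (U : Ultrafilter Role) (A : Formula L Role)
      (t : L.Term ℕ) :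
      R ∉ U → Derivable (⟨R, A.inst t⟩ ::ₘ Γ) →
      Derivable (⟨R, Formula.all U A⟩ ::ₘ Γ)
  | all_pos (Γ : Sequent L Role) (R : Set Role) (U : Ultrafilter Role) (A : Formula L Role) :
      R ∈ U → Derivable (⟨R, A⟩ ::ₘ Γ.map IFormula.shift) →
      Derivable (⟨R, Formula.all U A⟩ ::ₘ Γ)

end LMRL

/-!
The binary cut with residual is the heart of the matter; the cut with several premises follows.
Cutting `[R₁]A` against `[R₂]A` leaves `[R₁ ∩ R₂]A`, whose role set has complement
`R₁ᶜ ∪ R₂ᶜ`, so the residual can be cut again against a further premise. After all `n` premises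
have been used, the residual is `[∅]A`, because the complements cover all roles. An i-formula
without roles carries no information and can be dropped (`Derivable.drop_empty`): no ultrafilter
contains `∅`, so the connectives indexed by ultrafilters are introduced by negative rules only, and
an axiom stays an axiom when an empty block of its partition is removed.

The binary cut (`cutAdmissible`) is admissible by Gentzen's method, by induction on the size of the
cut formula. Disjointness of `R₁ᶜ` and `R₂ᶜ` says that `R₁ ∪ R₂` is the set of all roles. Hence for
every ultrafilter `U` at least one of `R₁`, `R₂` belongs to `U`, and `R₁ ∩ R₂` belongs to `U`
exactly when both do. So two principal rules are either both positive, and the positive rule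
introduces the residual, or they are of opposite signs, and the negative rule introduces it; the
premises are supplied by cuts on smaller formulas (`cut_of_endsIn`). For atoms, removing the blocks
`R₁` and `R₂` from two partitions leaves partitions of `R₁ᶜ` and `R₂ᶜ`, which `R₁ ∩ R₂` completes
to a partition of all roles (`IsAxiom.cut`).

The two cut formulas are brought into principal position by `Derivable.replace`, which says once and
for all that replacing part of a sequent commutes with the rules. First the derivation is followed
whose cut formula is not subject to contraction (at most one of the two is), then the other one. If
the latter is `[R₂]!_U B` with `R₂ ∉ U`, the former ends in promotion, and all copies of `[R₂]!_U B`
produced by contraction are replaced simultaneously (`cut_of_promotion`).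
-/

namespace LMRL

/-! ### Substitution -/

theorem relabel_succ_subst_liftSubst {L : FirstOrder.Language.{u, v}} (s : ℕ → L.Term ℕ)
    (t : L.Term ℕ) :
    (t.relabel Nat.succ).subst (liftSubst s) = (t.subst s).relabel Nat.succ := by
  induction t with
  | var k => rfl
  | func f ts ih => simp [FirstOrder.Language.Term.subst, FirstOrder.Language.Term.relabel, ih]

theorem term_subst_subst {L : FirstOrder.Language.{u, v}} (s s' : ℕ → L.Term ℕ)
    (t : L.Term ℕ) : (t.subst s).subst s' = t.subst (fun k => (s k).subst s') := by
  induction t with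
  | var k => rfl
  | func f ts ih => simp [FirstOrder.Language.Term.subst, ih]

theorem term_subst_var {L : FirstOrder.Language.{u, v}} (t : L.Term ℕ) :
    t.subst FirstOrder.Language.Term.var = t := by
  induction t with
  | var k => rfl
  | func f ts ih => simp [FirstOrder.Language.Term.subst, ih]

theorem term_relabel_succ {L : FirstOrder.Language.{u, v}} (t : L.Term ℕ) :
    t.relabel Nat.succ = t.subst (fun k => FirstOrder.Language.Term.var (k + 1)) := by
  induction t with
  | var k => rfl
  | func f ts ih =>
    simp [FirstOrder.Language.Term.subst, FirstOrder.Language.Term.relabel, ih]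

theorem liftSubst_var {L : FirstOrder.Language.{u, v}} :
    liftSubst (L := L) FirstOrder.Language.Term.var = FirstOrder.Language.Term.var := by
  funext k
  cases k <;> rfl

theorem liftSubst_comp {L : FirstOrder.Language.{u, v}} (s s' : ℕ → L.Term ℕ) :
    (fun k => (liftSubst s k).subst (liftSubst s')) =
      liftSubst (fun k => (s k).subst s') := by
  funext k
  cases k with
  | zero => rfl
  | succ k => exact relabel_succ_subst_liftSubst s' (s k)

namespace Formula

variable {L : FirstOrder.Language.{u, v}} {Role : Type w}

theorem subst_subst (A : Formula L Role) (s s' : ℕ → L.Term ℕ) :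
    (A.subst s).subst s' = A.subst (fun k => (s k).subst s') := by
  induction A generalizing s s' with
  | atom P ts => simp [subst, term_subst_subst]
  | neg f A ih => simp [subst, ih]
  | tensor U A B ihA ihB => simp [subst, ihA, ihB]
  | amp U A B ihA ihB => simp [subst, ihA, ihB]
  | bang U A ih => simp [subst, ih]
  | all U A ih => simp [subst, ih, liftSubst_comp]

theorem subst_var (A : Formula L Role) : A.subst FirstOrder.Language.Term.var = A := by
  induction A with
  | atom P ts => simp [subst, term_subst_var]
  | neg f A ih => simp [subst, ih]
  | tensor U A B ihA ihB => simp [subst, ihA, ihB]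
  | amp U A B ihA ihB => simp [subst, ihA, ihB]
  | bang U A ih => simp [subst, ih]
  | all U A ih => simp [subst, ih, liftSubst_var]

theorem shift_subst_liftSubst (A : Formula L Role) (s : ℕ → L.Term ℕ) :
    A.shift.subst (liftSubst s) = (A.subst s).shift := by
  simp only [shift, subst_subst]
  congr 1
  funext k
  exact term_relabel_succ (s k)

theorem inst_subst (A : Formula L Role) (t : L.Term ℕ) (s : ℕ → L.Term ℕ) :
    (A.inst t).subst s = (A.subst (liftSubst s)).inst (t.subst s) := by
  simp only [inst, subst_subst]
  congr 1
  funext k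
  cases k with
  | zero => rfl
  | succ k =>
    simp only [liftSubst, term_relabel_succ, term_subst_subst]
    exact (term_subst_var (s k)).symm

theorem shift_inst (A : Formula L Role) (t : L.Term ℕ) : A.shift.inst t = A := by
  simp only [shift, inst, subst_subst]
  exact subst_var A

/-- The number of connectives. Unlike the subformula relation, it is insensitive to substitution,
and so it can serve as the measure for the cut formula. -/
def size : Formula L Role → ℕ
  | atom _ _ => 0
  | neg _ A => size A + 1
  | tensor _ A B => size A + size B + 1
  | amp _ A B => size A + size B + 1
  | bang _ A => size A + 1
  | all _ A => size A + 1

theorem size_subst (A : Formula L Role) (s : ℕ → L.Term ℕ) : (A.subst s).size = A.size := by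
  induction A generalizing s <;> simp_all [subst, size]

/-- Primitive formulas. -/
def IsAtom (A : Formula L Role) : Prop :=
  ∃ (k : ℕ) (P : L.Relations k) (ts : Fin k → L.Term ℕ), A = atom P ts

theorem IsAtom.subst {A : Formula L Role} (h : A.IsAtom) (s : ℕ → L.Term ℕ) :
    (A.subst s).IsAtom := by
  obtain ⟨k, P, ts, rfl⟩ := h
  exact ⟨k, P, _, rfl⟩

end Formula

namespace IFormula

variable {L : FirstOrder.Language.{u, v}} {Role : Type w}

/-- Substitution in the formula of an i-formula; the role set is unaffected. -/
def subst (s : ℕ → L.Term ℕ) (F : IFormula L Role) : IFormula L Role :=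
  ⟨F.roles, F.formula.subst s⟩

theorem IsWhyNot.subst {F : IFormula L Role} (h : F.IsWhyNot) (s : ℕ → L.Term ℕ) :
    (F.subst s).IsWhyNot := by
  obtain ⟨U, A, hF, hU⟩ := h
  exact ⟨U, A.subst s, by simp [IFormula.subst, hF, Formula.subst], hU⟩

theorem isWhyNot_of_subst {F : IFormula L Role} {s : ℕ → L.Term ℕ} (h : (F.subst s).IsWhyNot) :
    F.IsWhyNot := by
  obtain ⟨R, A⟩ := F
  obtain ⟨U, B, hF, hU⟩ := h
  cases A with
  | bang V A =>
    simp only [IFormula.subst, Formula.subst, Formula.bang.injEq] at hF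
    exact ⟨V, A, rfl, hF.1 ▸ hU⟩
  | _ => simp [IFormula.subst, Formula.subst] at hF

theorem isWhyNot_mk_bang {R : Set Role} {U : Ultrafilter Role} {A : Formula L Role} :
    (⟨R, Formula.bang U A⟩ : IFormula L Role).IsWhyNot ↔ R ∉ U := by
  constructor
  · rintro ⟨V, B, h, hR⟩
    cases h
    exact hR
  · exact fun h => ⟨U, A, rfl, h⟩

end IFormula

section Calculus

variable {L : FirstOrder.Language.{u, v}} {Role : Type w}

/-! ### Axioms -/

/-- The sequents `[R₁]a, …, [Rₙ]a` with `R₁ ⊎ ⋯ ⊎ Rₙ` the full set of roles. Partition is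
expressed by counting: each role lies in exactly one of the `Rᵢ`. -/
def IsAxiom (Γ : Sequent L Role) : Prop :=
  ∃ a : Formula L Role, a.IsAtom ∧ (∀ F ∈ Γ, F.formula = a) ∧
    ∀ r, (Γ.map fun F => F.roles.indicator (fun _ => 1) r).sum = 1

/-- The role sets form a partition if and only if each role lies in exactly one of them. -/
theorem isRolePartition_iff {n : ℕ} (R : Fin n → Set Role) :
    IsRolePartition R ↔ ∀ r, ∑ i, (R i).indicator (fun _ => 1) r = 1 := by
  classical
  have key : ∀ r, ∑ i, (R i).indicator (fun _ => 1) r =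
      (Finset.univ.filter fun i => r ∈ R i).card := fun r => by
    simp [Set.indicator_apply]
  simp only [key, Finset.card_eq_one, Finset.ext_iff, Finset.mem_filter, Finset.mem_univ,
    true_and, Finset.mem_singleton]
  constructor
  · rintro ⟨hd, hu⟩ r
    obtain ⟨i, hi⟩ := Set.mem_iUnion.1 (hu ▸ Set.mem_univ r)
    refine ⟨i, fun j => ⟨fun hj => ?_, fun h => h ▸ hi⟩⟩
    by_contra hij
    exact Set.disjoint_left.1 (hd j i hij) hj hi
  · intro h
    refine ⟨fun i j hij => Set.disjoint_left.2 fun r hi hj => ?_, ?_⟩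
    · obtain ⟨k, hk⟩ := h r
      exact hij (((hk i).1 hi).trans ((hk j).1 hj).symm)
    · refine Set.eq_univ_of_forall fun r => ?_
      obtain ⟨k, hk⟩ := h r
      exact Set.mem_iUnion.2 ⟨k, (hk k).2 rfl⟩

theorem isAxiom_sum {n : ℕ} {R : Fin n → Set Role} (hR : IsRolePartition R)
    {k : ℕ} (P : L.Relations k) (ts : Fin k → L.Term ℕ) :
    IsAxiom (∑ i, {(⟨R i, Formula.atom P ts⟩ : IFormula L Role)}) := by
  refine ⟨_, ⟨k, P, ts, rfl⟩, fun F hF => ?_, fun r => ?_⟩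
  · obtain ⟨i, -, hi⟩ := Multiset.mem_sum.1 hF
    rw [Multiset.mem_singleton.1 hi]
  · refine Eq.trans ?_ ((isRolePartition_iff R).1 hR r)
    rw [← Multiset.coe_mapAddMonoidHom, map_sum, ← Multiset.coe_sumAddMonoidHom, map_sum]
    simp

theorem IsAxiom.derivable {Γ : Sequent L Role} (h : IsAxiom Γ) : Derivable Γ := by
  obtain ⟨a, ⟨k, P, ts, rfl⟩, hΓ, hr⟩ := h
  induction Γ using Quotient.inductionOn with | h l => ?_
  simp only [Multiset.quot_mk_to_coe] at hΓ hr ⊢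
  have hl : (l : Sequent L Role) =
      ∑ i : Fin l.length, {(⟨(l.get i).roles, Formula.atom P ts⟩ : IFormula L Role)} := by
    have hget : ∀ i : Fin l.length,
        (⟨(l.get i).roles, Formula.atom P ts⟩ : IFormula L Role) = l.get i := fun i => by
      rw [← hΓ (l.get i) (Multiset.mem_coe.2 (l.get_mem i))]
    simp only [hget]
    rw [← List.sum_ofFn, ← Multiset.sum_coe, ← Multiset.sum_map_singleton (l : Sequent L Role),
      Multiset.map_coe]
    conv_lhs => rw [← List.ofFn_get l, List.map_ofFn]
    rfl
  rw [hl]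
  refine Derivable.id _ ((isRolePartition_iff _).2 fun r => ?_) P ts
  refine Eq.trans ?_ (hr r)
  rw [← List.sum_ofFn, Multiset.map_coe, Multiset.sum_coe]
  conv_rhs => rw [← List.ofFn_get l, List.map_ofFn]
  rfl

theorem IsAxiom.subst {Γ : Sequent L Role} (h : IsAxiom Γ) (s : ℕ → L.Term ℕ) :
    IsAxiom (Γ.map (IFormula.subst s)) := by
  obtain ⟨a, ha, hΓ, hr⟩ := h
  refine ⟨a.subst s, ha.subst s, fun F hF => ?_, fun r => ?_⟩
  · obtain ⟨G, hG, rfl⟩ := Multiset.mem_map.1 hF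
    exact congrArg _ (hΓ G hG)
  · rw [Multiset.map_map]
    exact hr r

/-- The cut of two axioms on their atom is an axiom. -/
theorem IsAxiom.cut {R₁ R₂ : Set Role} {A : Formula L Role} {Γ₁ Γ₂ : Sequent L Role}
    (hR : R₁ ∪ R₂ = Set.univ) (h₁ : IsAxiom (⟨R₁, A⟩ ::ₘ Γ₁)) (h₂ : IsAxiom (⟨R₂, A⟩ ::ₘ Γ₂)) :
    IsAxiom (⟨R₁ ∩ R₂, A⟩ ::ₘ (Γ₁ + Γ₂)) := by
  classical
  obtain ⟨a, ha, hΓ₁, hr₁⟩ := h₁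
  obtain ⟨b, -, hΓ₂, hr₂⟩ := h₂
  obtain rfl : A = a := hΓ₁ _ (Multiset.mem_cons_self _ _)
  obtain rfl : A = b := hΓ₂ _ (Multiset.mem_cons_self _ _)
  refine ⟨A, ha, fun F hF => ?_, fun r => ?_⟩
  · rcases Multiset.mem_cons.1 hF with rfl | hF
    · rfl
    rcases Multiset.mem_add.1 hF with hF | hF
    exacts [hΓ₁ F (Multiset.mem_cons_of_mem hF), hΓ₂ F (Multiset.mem_cons_of_mem hF)]
  · have e₁ := hr₁ r
    have e₂ := hr₂ r
    have hr : r ∈ R₁ ∨ r ∈ R₂ := (Set.mem_union _ _ _).1 (hR ▸ Set.mem_univ r)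
    simp only [Multiset.map_cons, Multiset.sum_cons, Multiset.map_add, Multiset.sum_add,
      Set.indicator_apply, Set.mem_inter_iff] at e₁ e₂ ⊢
    by_cases hr₁ : r ∈ R₁ <;> by_cases hr₂ : r ∈ R₂ <;> simp_all

/-! ### The last rule of a derivation -/

/-- `Step D F Γ`: the sequent `F, Γ` is the conclusion of a rule other than the axiom whose
principal i-formula is `F` and whose premises satisfy `D`. -/
inductive Step (D : Sequent L Role → Prop) : IFormula L Role → Sequent L Role → Prop
  | neg {Γ : Sequent L Role} {R : Set Role} {f : Role → Role} {A : Formula L Role} :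
      D (⟨f ⁻¹' R, A⟩ ::ₘ Γ) → Step D ⟨R, Formula.neg f A⟩ Γ
  | amp_neg_l {Γ : Sequent L Role} {R : Set Role} {U : Ultrafilter Role} {A B : Formula L Role} :
      R ∉ U → D (⟨R, A⟩ ::ₘ Γ) → Step D ⟨R, Formula.amp U A B⟩ Γ
  | amp_neg_r {Γ : Sequent L Role} {R : Set Role} {U : Ultrafilter Role} {A B : Formula L Role} :
      R ∉ U → D (⟨R, B⟩ ::ₘ Γ) → Step D ⟨R, Formula.amp U A B⟩ Γ
  | amp_pos {Γ : Sequent L Role} {R : Set Role} {U : Ultrafilter Role} {A B : Formula L Role} :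
      R ∈ U → D (⟨R, A⟩ ::ₘ Γ) → D (⟨R, B⟩ ::ₘ Γ) → Step D ⟨R, Formula.amp U A B⟩ Γ
  | tensor_neg {Γ : Sequent L Role} {R : Set Role} {U : Ultrafilter Role} {A B : Formula L Role} :
      R ∉ U → D (⟨R, A⟩ ::ₘ ⟨R, B⟩ ::ₘ Γ) → Step D ⟨R, Formula.tensor U A B⟩ Γ
  | tensor_pos {Γ₁ Γ₂ : Sequent L Role} {R : Set Role} {U : Ultrafilter Role}
      {A B : Formula L Role} :
      R ∈ U → D (⟨R, A⟩ ::ₘ Γ₁) → D (⟨R, B⟩ ::ₘ Γ₂) →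
      Step D ⟨R, Formula.tensor U A B⟩ (Γ₁ + Γ₂)
  | bang_pos {Γ : Sequent L Role} {R : Set Role} {U : Ultrafilter Role} {A : Formula L Role} :
      R ∈ U → (∀ F ∈ Γ, F.IsWhyNot) → D (⟨R, A⟩ ::ₘ Γ) → Step D ⟨R, Formula.bang U A⟩ Γ
  | bang_neg_weaken {Γ : Sequent L Role} {R : Set Role} {U : Ultrafilter Role}
      {A : Formula L Role} :
      R ∉ U → D Γ → Step D ⟨R, Formula.bang U A⟩ Γ
  | bang_neg_derelict {Γ : Sequent L Role} {R : Set Role} {U : Ultrafilter Role}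
      {A : Formula L Role} :
      R ∉ U → D (⟨R, A⟩ ::ₘ Γ) → Step D ⟨R, Formula.bang U A⟩ Γ
  | bang_neg_contract {Γ : Sequent L Role} {R : Set Role} {U : Ultrafilter Role}
      {A : Formula L Role} :
      R ∉ U → D (⟨R, Formula.bang U A⟩ ::ₘ ⟨R, Formula.bang U A⟩ ::ₘ Γ) →
      Step D ⟨R, Formula.bang U A⟩ Γ
  | all_neg {Γ : Sequent L Role} {R : Set Role} {U : Ultrafilter Role} {A : Formula L Role}
      (t : L.Term ℕ) :
      R ∉ U → D (⟨R, A.inst t⟩ ::ₘ Γ) → Step D ⟨R, Formula.all U A⟩ Γ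
  | all_pos {Γ : Sequent L Role} {R : Set Role} {U : Ultrafilter Role} {A : Formula L Role} :
      R ∈ U → D (⟨R, A⟩ ::ₘ Γ.map IFormula.shift) → Step D ⟨R, Formula.all U A⟩ Γ

theorem Step.mono {D D' : Sequent L Role → Prop} (hD : ∀ Γ, D Γ → D' Γ) {F : IFormula L Role}
    {Γ : Sequent L Role} (h : Step D F Γ) : Step D' F Γ := by
  cases h with
  | neg h => exact .neg (hD _ h)
  | amp_neg_l hU h => exact .amp_neg_l hU (hD _ h)
  | amp_neg_r hU h => exact .amp_neg_r hU (hD _ h)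
  | amp_pos hU h h' => exact .amp_pos hU (hD _ h) (hD _ h')
  | tensor_neg hU h => exact .tensor_neg hU (hD _ h)
  | tensor_pos hU h h' => exact .tensor_pos hU (hD _ h) (hD _ h')
  | bang_pos hU hΓ h => exact .bang_pos hU hΓ (hD _ h)
  | bang_neg_weaken hU h => exact .bang_neg_weaken hU (hD _ h)
  | bang_neg_derelict hU h => exact .bang_neg_derelict hU (hD _ h)
  | bang_neg_contract hU h => exact .bang_neg_contract hU (hD _ h)
  | all_neg t hU h => exact .all_neg t hU (hD _ h)
  | all_pos hU h => exact .all_pos hU (hD _ h)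

theorem Step.derivable {F : IFormula L Role} {Γ : Sequent L Role} (h : Step Derivable F Γ) :
    Derivable (F ::ₘ Γ) := by
  cases h with
  | neg h => exact .neg _ _ _ _ h
  | amp_neg_l hU h => exact .amp_neg_l _ _ _ _ _ hU h
  | amp_neg_r hU h => exact .amp_neg_r _ _ _ _ _ hU h
  | amp_pos hU h h' => exact .amp_pos _ _ _ _ _ hU h h'
  | tensor_neg hU h => exact .tensor_neg _ _ _ _ _ hU h
  | tensor_pos hU h h' => exact .tensor_pos _ _ _ _ _ _ hU h h'
  | bang_pos hU hΓ h => exact .bang_pos _ _ _ _ hU hΓ h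
  | bang_neg_weaken hU h => exact .bang_neg_weaken _ _ _ _ hU h
  | bang_neg_derelict hU h => exact .bang_neg_derelict _ _ _ _ hU h
  | bang_neg_contract hU h => exact .bang_neg_contract _ _ _ _ hU h
  | all_neg t hU h => exact .all_neg _ _ _ _ t hU h
  | all_pos hU h => exact .all_pos _ _ _ _ hU h

/-- Induction on derivations, with the last rule presented as an axiom or as a `Step`. -/
theorem Derivable.step_induction {M : Sequent L Role → Prop}
    (ax : ∀ Γ, IsAxiom Γ → M Γ)
    (step : ∀ F Γ, Step (fun Δ => Derivable Δ ∧ M Δ) F Γ → M (F ::ₘ Γ))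
    {Γ : Sequent L Role} (h : Derivable Γ) : M Γ := by
  induction h with
  | id R hR P ts => exact ax _ (isAxiom_sum hR P ts)
  | neg _ _ _ _ h ih => exact step _ _ (.neg ⟨h, ih⟩)
  | amp_neg_l _ _ _ _ _ hU h ih => exact step _ _ (.amp_neg_l hU ⟨h, ih⟩)
  | amp_neg_r _ _ _ _ _ hU h ih => exact step _ _ (.amp_neg_r hU ⟨h, ih⟩)
  | amp_pos _ _ _ _ _ hU h h' ih ih' => exact step _ _ (.amp_pos hU ⟨h, ih⟩ ⟨h', ih'⟩)
  | tensor_neg _ _ _ _ _ hU h ih => exact step _ _ (.tensor_neg hU ⟨h, ih⟩)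
  | tensor_pos _ _ _ _ _ _ hU h h' ih ih' => exact step _ _ (.tensor_pos hU ⟨h, ih⟩ ⟨h', ih'⟩)
  | bang_pos _ _ _ _ hU hΓ h ih => exact step _ _ (.bang_pos hU hΓ ⟨h, ih⟩)
  | bang_neg_weaken _ _ _ _ hU h ih => exact step _ _ (.bang_neg_weaken hU ⟨h, ih⟩)
  | bang_neg_derelict _ _ _ _ hU h ih => exact step _ _ (.bang_neg_derelict hU ⟨h, ih⟩)
  | bang_neg_contract _ _ _ _ hU h ih => exact step _ _ (.bang_neg_contract hU ⟨h, ih⟩)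
  | all_neg _ _ _ _ t hU h ih => exact step _ _ (.all_neg t hU ⟨h, ih⟩)
  | all_pos _ _ _ _ hU h ih => exact step _ _ (.all_pos hU ⟨h, ih⟩)

/-! ### Substitution, weakening and contraction in derivations -/

theorem map_shift_map_subst_liftSubst (Γ : Sequent L Role) (s : ℕ → L.Term ℕ) :
    (Γ.map IFormula.shift).map (IFormula.subst (liftSubst s)) =
      (Γ.map (IFormula.subst s)).map IFormula.shift := by
  simp only [Multiset.map_map]
  refine Multiset.map_congr rfl fun F _ => ?_
  exact congrArg (IFormula.mk F.roles) (F.formula.shift_subst_liftSubst s)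

/-- The premise of the positive rule for `∀` has one more free variable, so `s` acts on it through
`liftSubst s`; the hypothesis on `D` therefore covers all substitutions. -/
theorem Step.subst {D D' : Sequent L Role → Prop}
    (hD : ∀ Γ s, D Γ → D' (Γ.map (IFormula.subst s))) {F : IFormula L Role} {Γ : Sequent L Role}
    (h : Step D F Γ) (s : ℕ → L.Term ℕ) : Step D' (F.subst s) (Γ.map (IFormula.subst s)) := by
  have key : ∀ s G Γ, D (G ::ₘ Γ) → D' (G.subst s ::ₘ Γ.map (IFormula.subst s)) :=
    fun s G Γ h => by simpa only [Multiset.map_cons] using hD _ s h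
  have key₂ : ∀ G G' Γ, D (G ::ₘ G' ::ₘ Γ) →
      D' (G.subst s ::ₘ G'.subst s ::ₘ Γ.map (IFormula.subst s)) :=
    fun G G' Γ h => by simpa only [Multiset.map_cons] using hD _ s h
  cases h with
  | neg h => exact .neg (key s _ _ h)
  | amp_neg_l hU h => exact .amp_neg_l hU (key s _ _ h)
  | amp_neg_r hU h => exact .amp_neg_r hU (key s _ _ h)
  | amp_pos hU h h' => exact .amp_pos hU (key s _ _ h) (key s _ _ h')
  | tensor_neg hU h => exact .tensor_neg hU (key₂ _ _ _ h)
  | tensor_pos hU h h' =>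
    rw [Multiset.map_add]
    exact .tensor_pos hU (key s _ _ h) (key s _ _ h')
  | bang_pos hU hΓ h =>
    refine .bang_pos hU (fun F hF => ?_) (key s _ _ h)
    obtain ⟨G, hG, rfl⟩ := Multiset.mem_map.1 hF
    exact (hΓ G hG).subst s
  | bang_neg_weaken hU h => exact .bang_neg_weaken hU (hD _ s h)
  | bang_neg_derelict hU h => exact .bang_neg_derelict hU (key s _ _ h)
  | bang_neg_contract hU h => exact .bang_neg_contract hU (key₂ _ _ _ h)
  | all_neg t hU h =>
    refine .all_neg (t.subst s) hU ?_
    rw [← Formula.inst_subst]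
    exact key s _ _ h
  | all_pos hU h =>
    refine .all_pos hU ?_
    rw [← map_shift_map_subst_liftSubst]
    exact key (liftSubst s) _ _ h

theorem Derivable.subst {Γ : Sequent L Role} (h : Derivable Γ) (s : ℕ → L.Term ℕ) :
    Derivable (Γ.map (IFormula.subst s)) := by
  refine Derivable.step_induction (M := fun Γ => ∀ s, Derivable (Γ.map (IFormula.subst s)))
    (fun Γ h s => (h.subst s).derivable) (fun F Γ h s => ?_) h s
  rw [Multiset.map_cons]
  exact (h.subst (fun Δ s hΔ => hΔ.2 s) s).derivable

/-- Instantiation of the eigenvariable of a premise of the positive rule for `∀`. -/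
theorem Derivable.inst {R : Set Role} {A : Formula L Role} {Γ : Sequent L Role}
    (h : Derivable (⟨R, A⟩ ::ₘ Γ.map IFormula.shift)) (t : L.Term ℕ) :
    Derivable (⟨R, A.inst t⟩ ::ₘ Γ) := by
  have := h.subst (fun k => Nat.casesOn k t (fun j => FirstOrder.Language.Term.var j))
  rw [Multiset.map_cons, Multiset.map_map] at this
  have hΓ : Γ.map (IFormula.subst (fun k => Nat.casesOn k t
      (fun j => FirstOrder.Language.Term.var j)) ∘ IFormula.shift) = Γ :=
    (Multiset.map_congr rfl fun F _ =>
      congrArg (IFormula.mk F.roles) (F.formula.shift_inst t)).trans (Multiset.map_id Γ)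
  rwa [hΓ] at this

theorem Derivable.weaken {Γ Θ : Sequent L Role} (hΘ : ∀ F ∈ Θ, F.IsWhyNot) (h : Derivable Γ) :
    Derivable (Γ + Θ) := by
  induction Θ using Multiset.induction with
  | empty => simpa using h
  | cons F Θ ih =>
    obtain ⟨R, A⟩ := F
    obtain ⟨U, B, rfl, hU⟩ := hΘ _ (Multiset.mem_cons_self _ _)
    rw [Multiset.add_cons]
    exact .bang_neg_weaken _ _ _ _ hU (ih fun F hF => hΘ F (Multiset.mem_cons_of_mem hF))

theorem Derivable.contract {Γ Θ : Sequent L Role} (hΘ : ∀ F ∈ Θ, F.IsWhyNot)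
    (h : Derivable (Γ + Θ + Θ)) : Derivable (Γ + Θ) := by
  induction Θ using Multiset.induction generalizing Γ with
  | empty => simpa using h
  | cons F Θ ih =>
    obtain ⟨R, A⟩ := F
    obtain ⟨U, B, rfl, hU⟩ := hΘ _ (Multiset.mem_cons_self _ _)
    rw [Multiset.add_cons, ← Multiset.cons_add]
    refine ih (fun F hF => hΘ F (Multiset.mem_cons_of_mem hF)) ?_
    rw [Multiset.cons_add, Multiset.cons_add]
    refine .bang_neg_contract _ _ _ _ hU ?_
    simpa only [Multiset.add_cons, Multiset.cons_add] using h

/-! ### Commutation with the rules -/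

/-- A common refinement of two decompositions of a multiset. -/
theorem exists_add_of_add_eq_add {α : Type*} {a b c d : Multiset α} (h : a + b = c + d) :
    ∃ c₁ c₂ d₁ d₂, c = c₁ + c₂ ∧ d = d₁ + d₂ ∧ a = c₁ + d₁ ∧ b = c₂ + d₂ := by
  classical
  have hc : ∀ x, a.count x + b.count x = c.count x + d.count x := fun x => by
    simpa using congrArg (Multiset.count x) h
  refine ⟨a ∩ c, c - a, a - c, d - (a - c), ?_, ?_, ?_, ?_⟩ <;> ext x <;>
    simp only [Multiset.count_add, Multiset.count_inter, Multiset.count_sub] <;>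
    have := hc x <;> omega

/-- Commutation of a replacement with the rules. Suppose that `Rep Φ Θ` relates sequents in a way
compatible with renaming, with splitting a context between two premises, and with the side
condition of the rule for `!`. If `Φ` may be replaced by `Θ` in axioms, and in conclusions of rules
whose principal i-formula belongs to `Φ` (assuming that all replacements can be made in the
premises), then `Φ` may be replaced by `Θ` in every derivable sequent. -/
theorem Derivable.replace {Rep : Sequent L Role → Sequent L Role → Prop}
    (shift : ∀ Φ Θ, Rep Φ Θ → Rep (Φ.map IFormula.shift) (Θ.map IFormula.shift))
    (split : ∀ Φ₁ Φ₂ Θ, Rep (Φ₁ + Φ₂) Θ → ∃ Θ₁ Θ₂, Rep Φ₁ Θ₁ ∧ Rep Φ₂ Θ₂ ∧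
      ∀ Δ, Derivable (Δ + Θ₁ + Θ₂) → Derivable (Δ + Θ))
    (whyNot : ∀ Φ Θ, Rep Φ Θ → (∀ F ∈ Φ, F.IsWhyNot) → ∀ F ∈ Θ, F.IsWhyNot)
    (ax : ∀ Φ Θ Δ, Rep Φ Θ → IsAxiom (Φ + Δ) → Derivable (Δ + Θ))
    (principal : ∀ F Φ Θ Δ, Rep (F ::ₘ Φ) Θ →
      Step (fun Γ => Derivable Γ ∧ ∀ Φ Θ Δ, Rep Φ Θ → Γ = Φ + Δ → Derivable (Δ + Θ)) F (Φ + Δ) →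
      Derivable (Δ + Θ))
    {Φ Θ Δ : Sequent L Role} (hRep : Rep Φ Θ) (h : Derivable (Φ + Δ)) : Derivable (Δ + Θ) := by
  suffices H : ∀ Γ, Derivable Γ → ∀ Φ Θ Δ, Rep Φ Θ → Γ = Φ + Δ → Derivable (Δ + Θ) from
    H _ h Φ Θ Δ hRep rfl
  clear hRep h Φ Θ Δ
  intro Γ h
  refine Derivable.step_induction
    (M := fun Γ => ∀ Φ Θ Δ, Rep Φ Θ → Γ = Φ + Δ → Derivable (Δ + Θ)) ?_ ?_ h
  · rintro Γ h Φ Θ Δ hRep rfl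
    exact ax _ _ _ hRep h
  · clear h Γ
    intro F Γ h Φ Θ Δ hRep hΓ
    have hF : F ∈ Φ + Δ := hΓ ▸ Multiset.mem_cons_self F Γ
    rcases Multiset.mem_add.1 hF with hF | hF
    · obtain ⟨Φ, rfl⟩ := Multiset.exists_cons_of_mem hF
      rw [Multiset.cons_add, Multiset.cons_inj_right] at hΓ
      subst hΓ
      exact principal _ _ _ _ hRep h
    · obtain ⟨Δ, rfl⟩ := Multiset.exists_cons_of_mem hF
      rw [Multiset.add_cons, Multiset.cons_inj_right] at hΓ
      have key : ∀ G, Derivable (G ::ₘ Γ) ∧ (∀ Φ Θ Δ, Rep Φ Θ → G ::ₘ Γ = Φ + Δ →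
          Derivable (Δ + Θ)) → Derivable (G ::ₘ (Δ + Θ)) := fun G hG => by
        rw [← Multiset.cons_add]
        exact hG.2 _ _ _ hRep (by rw [hΓ, Multiset.add_cons])
      have key₂ : ∀ G G', Derivable (G ::ₘ G' ::ₘ Γ) ∧ (∀ Φ Θ Δ, Rep Φ Θ →
          G ::ₘ G' ::ₘ Γ = Φ + Δ → Derivable (Δ + Θ)) →
          Derivable (G ::ₘ G' ::ₘ (Δ + Θ)) := fun G G' hG => by
        rw [← Multiset.cons_add, ← Multiset.cons_add]
        exact hG.2 _ _ _ hRep (by rw [hΓ, Multiset.add_cons, Multiset.add_cons])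
      rw [Multiset.cons_add]
      cases h with
      | neg h => exact .neg _ _ _ _ (key _ h)
      | amp_neg_l hU h => exact .amp_neg_l _ _ _ _ _ hU (key _ h)
      | amp_neg_r hU h => exact .amp_neg_r _ _ _ _ _ hU (key _ h)
      | amp_pos hU h h' => exact .amp_pos _ _ _ _ _ hU (key _ h) (key _ h')
      | tensor_neg hU h => exact .tensor_neg _ _ _ _ _ hU (key₂ _ _ h)
      | tensor_pos hU h h' =>
        obtain ⟨Φ₁, Φ₂, Δ₁, Δ₂, rfl, rfl, rfl, rfl⟩ := exists_add_of_add_eq_add hΓ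
        obtain ⟨Θ₁, Θ₂, h₁, h₂, hΘ⟩ := split _ _ _ hRep
        have k₁ := h.2 _ _ _ h₁ (Multiset.add_cons _ _ _).symm
        have k₂ := h'.2 _ _ _ h₂ (Multiset.add_cons _ _ _).symm
        rw [Multiset.cons_add] at k₁ k₂
        rw [← Multiset.cons_add]
        apply hΘ
        rw [Multiset.cons_add, Multiset.cons_add]
        convert Derivable.tensor_pos _ _ _ _ _ _ hU k₁ k₂ using 2
        abel
      | bang_pos hU hW h =>
        refine .bang_pos _ _ _ _ hU (fun F hF => ?_) (key _ h)
        subst hΓ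
        rcases Multiset.mem_add.1 hF with hF | hF
        · exact hW F (Multiset.mem_add.2 (.inr hF))
        · exact whyNot _ _ hRep (fun F hF => hW F (Multiset.mem_add.2 (.inl hF))) F hF
      | bang_neg_weaken hU h => exact .bang_neg_weaken _ _ _ _ hU (h.2 _ _ _ hRep hΓ)
      | bang_neg_derelict hU h => exact .bang_neg_derelict _ _ _ _ hU (key _ h)
      | bang_neg_contract hU h => exact .bang_neg_contract _ _ _ _ hU (key₂ _ _ h)
      | all_neg t hU h => exact .all_neg _ _ _ _ t hU (key _ h)
      | all_pos hU h =>
        refine .all_pos _ _ _ _ hU ?_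
        rw [Multiset.map_add, ← Multiset.cons_add]
        exact h.2 _ _ _ (shift _ _ hRep) (by rw [hΓ, Multiset.map_add, Multiset.add_cons])

/-! ### I-formulas without roles -/

/-- I-formulas without roles may be dropped: `∅` belongs to no ultrafilter, so no positive rule
has such a principal i-formula, and the other rules disappear when it is dropped. -/
theorem Derivable.drop_empty {Φ Δ : Sequent L Role} (hΦ : ∀ F ∈ Φ, F.roles = ∅)
    (h : Derivable (Φ + Δ)) : Derivable Δ := by
  have := Derivable.replace (Rep := fun Φ Θ => Θ = 0 ∧ ∀ F ∈ Φ, F.roles = ∅)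
    (Θ := 0) ?_ ?_ ?_ ?_ ?_ ⟨rfl, hΦ⟩ h
  · simpa using this
  · rintro Φ _ ⟨rfl, h⟩
    refine ⟨rfl, fun F hF => ?_⟩
    obtain ⟨G, hG, rfl⟩ := Multiset.mem_map.1 hF
    exact h G hG
  · rintro Φ₁ Φ₂ _ ⟨rfl, h⟩
    exact ⟨0, 0, ⟨rfl, fun F hF => h F (Multiset.mem_add.2 (.inl hF))⟩,
      ⟨rfl, fun F hF => h F (Multiset.mem_add.2 (.inr hF))⟩, fun Δ h => by simpa using h⟩
  · rintro Φ _ ⟨rfl, h⟩ - F hF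
    simp at hF
  · rintro Φ _ Δ ⟨rfl, h⟩ ⟨a, ha, hΓ, hr⟩
    rw [add_zero]
    refine IsAxiom.derivable ⟨a, ha, fun F hF => hΓ F (Multiset.mem_add.2 (.inr hF)), fun r => ?_⟩
    have e := hr r
    rw [Multiset.map_add, Multiset.sum_add] at e
    refine Eq.trans (left_eq_add.2 ?_) ((add_comm _ _).trans e)
    refine Multiset.sum_eq_zero fun x hx => ?_
    obtain ⟨F, hF, rfl⟩ := Multiset.mem_map.1 hx
    simp [h F hF]
  · rintro F Φ _ Δ ⟨rfl, h⟩ hstep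
    have hF := h F (Multiset.mem_cons_self _ _)
    have hΦ : ∀ G ∈ Φ, G.roles = ∅ := fun G hG => h G (Multiset.mem_cons_of_mem hG)
    have cons : ∀ {Φ : Sequent L Role} (A : Formula L Role), (∀ G ∈ Φ, G.roles = ∅) →
        ∀ G ∈ (⟨∅, A⟩ ::ₘ Φ : Sequent L Role), G.roles = ∅ := fun A h G hG => by
      rcases Multiset.mem_cons.1 hG with rfl | hG
      exacts [rfl, h G hG]
    obtain ⟨R, A⟩ := F
    obtain rfl : R = ∅ := hF
    generalize hΓ : Φ + Δ = Γ at hstep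
    have key : ∀ A, Derivable (⟨∅, A⟩ ::ₘ Γ) ∧ (∀ Φ Θ Δ, (Θ = 0 ∧ ∀ F ∈ Φ, F.roles = ∅) →
        ⟨∅, A⟩ ::ₘ Γ = Φ + Δ → Derivable (Δ + Θ)) → Derivable (Δ + 0) := fun A h =>
      h.2 _ _ _ ⟨rfl, cons A hΦ⟩ (by rw [← hΓ, Multiset.cons_add])
    have key₂ : ∀ A B, Derivable (⟨∅, A⟩ ::ₘ ⟨∅, B⟩ ::ₘ Γ) ∧
        (∀ Φ Θ Δ, (Θ = 0 ∧ ∀ F ∈ Φ, F.roles = ∅) →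
        ⟨∅, A⟩ ::ₘ ⟨∅, B⟩ ::ₘ Γ = Φ + Δ → Derivable (Δ + Θ)) → Derivable (Δ + 0) := fun A B h =>
      h.2 _ _ _ ⟨rfl, cons A (cons B hΦ)⟩ (by rw [← hΓ, Multiset.cons_add, Multiset.cons_add])
    cases hstep with
    | neg h => exact key _ h
    | amp_neg_l hU h => exact key _ h
    | amp_neg_r hU h => exact key _ h
    | amp_pos hU h h' => exact absurd hU Ultrafilter.empty_notMem
    | tensor_neg hU h => exact key₂ _ _ h
    | tensor_pos hU h h' => exact absurd hU Ultrafilter.empty_notMem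
    | bang_pos hU hW h => exact absurd hU Ultrafilter.empty_notMem
    | bang_neg_weaken hU h => exact h.2 _ _ _ ⟨rfl, hΦ⟩ hΓ.symm
    | bang_neg_derelict hU h => exact key _ h
    | bang_neg_contract hU h => exact key₂ _ _ h
    | all_neg t hU h => exact key _ h
    | all_pos hU h => exact absurd hU Ultrafilter.empty_notMem

/-! ### Binary cut with residual -/

/-- `EndsIn F Γ`: the sequent `F, Γ` is derivable by a derivation whose last rule is an axiom or
has `F` as its principal i-formula. -/
def EndsIn (F : IFormula L Role) (Γ : Sequent L Role) : Prop :=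
  Step Derivable F Γ ∨ IsAxiom (F ::ₘ Γ)

theorem EndsIn.shift {F : IFormula L Role} {Γ : Sequent L Role} (h : EndsIn F Γ) :
    EndsIn F.shift (Γ.map IFormula.shift) := by
  rcases h with h | h
  · exact .inl (h.subst (fun Γ s h => h.subst s) _)
  · refine .inr ?_
    have := h.subst (fun k => FirstOrder.Language.Term.var (k + 1))
    rwa [Multiset.map_cons] at this

/-- The replacement of a single occurrence, which cannot be duplicated or discarded. It suffices
to know how to replace it where the derivation introduces it. -/
theorem Derivable.replace_single {Rep : IFormula L Role → Sequent L Role → Prop}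
    (shift : ∀ F Θ, Rep F Θ → Rep F.shift (Θ.map IFormula.shift))
    (whyNot : ∀ F Θ, Rep F Θ → ¬ F.IsWhyNot)
    (ends : ∀ F Θ Δ, Rep F Θ → EndsIn F Δ → Derivable (Δ + Θ))
    {F : IFormula L Role} {Θ Δ : Sequent L Role} (hRep : Rep F Θ) (h : Derivable (F ::ₘ Δ)) :
    Derivable (Δ + Θ) := by
  refine Derivable.replace (Rep := fun Φ Θ => (Φ = 0 ∧ Θ = 0) ∨ ∃ F, Φ = {F} ∧ Rep F Θ)
    (Φ := {F}) ?_ ?_ ?_ ?_ ?_ (.inr ⟨F, rfl, hRep⟩) (by rwa [Multiset.singleton_add])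
  · rintro _ Θ (⟨rfl, rfl⟩ | ⟨F, rfl, h⟩)
    · exact .inl ⟨rfl, rfl⟩
    · exact .inr ⟨F.shift, Multiset.map_singleton _ _, shift _ _ h⟩
  · rintro Φ₁ Φ₂ Θ (⟨h, rfl⟩ | ⟨F, h, hF⟩)
    · obtain ⟨rfl, rfl⟩ := add_eq_zero.1 h
      exact ⟨0, 0, .inl ⟨rfl, rfl⟩, .inl ⟨rfl, rfl⟩, fun Δ h => by simpa using h⟩
    · have hcases : (Φ₁ = {F} ∧ Φ₂ = 0) ∨ (Φ₁ = 0 ∧ Φ₂ = {F}) := by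
        rcases Multiset.mem_add.1 (h ▸ Multiset.mem_singleton_self F) with hF | hF <;>
          obtain ⟨Ψ, rfl⟩ := Multiset.exists_cons_of_mem hF
        · rw [Multiset.cons_add] at h
          obtain ⟨rfl, rfl⟩ := add_eq_zero.1 ((Multiset.cons_inj_right F).1 h)
          exact .inl ⟨rfl, rfl⟩
        · rw [Multiset.add_cons] at h
          obtain ⟨rfl, rfl⟩ := add_eq_zero.1 ((Multiset.cons_inj_right F).1 h)
          exact .inr ⟨rfl, rfl⟩
      rcases hcases with ⟨rfl, rfl⟩ | ⟨rfl, rfl⟩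
      · exact ⟨Θ, 0, .inr ⟨F, rfl, hF⟩, .inl ⟨rfl, rfl⟩, fun Δ h => by simpa using h⟩
      · exact ⟨0, Θ, .inl ⟨rfl, rfl⟩, .inr ⟨F, rfl, hF⟩, fun Δ h => by simpa using h⟩
  · rintro _ Θ (⟨rfl, rfl⟩ | ⟨F, rfl, h⟩) hW
    · exact hW
    · exact absurd (hW F (Multiset.mem_singleton_self F)) (whyNot _ _ h)
  · rintro _ Θ Δ (⟨rfl, rfl⟩ | ⟨F, rfl, h⟩) hax
    · simpa using hax.derivable
    · exact ends _ _ _ h (.inr (by rwa [Multiset.singleton_add] at hax))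
  · rintro F Φ Θ Δ (⟨h, -⟩ | ⟨G, h, hG⟩) hstep
    · exact absurd h (Multiset.cons_ne_zero)
    · obtain rfl : F = G := Multiset.mem_singleton.1 (h ▸ Multiset.mem_cons_self F Φ)
      obtain rfl : Φ = 0 := (Multiset.cons_inj_right F).1 h
      rw [zero_add] at hstep
      exact ends _ _ _ hG (.inl (hstep.mono fun _ h => h.1))

/-- The cut of two i-formulas `[R₁]A` and `[R₂]A` whose role sets cover all roles, with residual
`[R₁ ∩ R₂]A`, is admissible. -/
def CutAdmissible (A : Formula L Role) : Prop :=
  ∀ (R₁ R₂ : Set Role) (Γ₁ Γ₂ : Sequent L Role), R₁ ∪ R₂ = Set.univ →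
    Derivable (⟨R₁, A⟩ ::ₘ Γ₁) → Derivable (⟨R₂, A⟩ ::ₘ Γ₂) →
    Derivable (⟨R₁ ∩ R₂, A⟩ ::ₘ (Γ₁ + Γ₂))

theorem mem_or_mem_of_union_eq_univ {R₁ R₂ : Set Role} (hR : R₁ ∪ R₂ = Set.univ)
    (U : Ultrafilter Role) : R₁ ∈ U ∨ R₂ ∈ U :=
  Ultrafilter.union_mem_iff.1 (hR ▸ Filter.univ_mem)

theorem inter_notMem_right {R₁ R₂ : Set Role} {U : Ultrafilter Role} (h : R₂ ∉ U) :
    R₁ ∩ R₂ ∉ U :=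
  fun h' => h (Filter.mem_of_superset h' Set.inter_subset_right)

/-- Of two role sets that cover all roles, at least one belongs to the ultrafilter of the cut
formula, and their intersection belongs to it if and only if both do. Hence the rule that
introduces the residual is the negative one exactly when one of the two rules is negative. -/
theorem cut_of_endsIn {A : Formula L Role}
    (ih : ∀ B : Formula L Role, B.size < A.size → CutAdmissible B)
    {R₁ R₂ : Set Role} {Γ₁ Γ₂ : Sequent L Role} (hR : R₁ ∪ R₂ = Set.univ)
    (hW₁ : ¬ (⟨R₁, A⟩ : IFormula L Role).IsWhyNot) (hW₂ : ¬ (⟨R₂, A⟩ : IFormula L Role).IsWhyNot)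
    (h₁ : EndsIn ⟨R₁, A⟩ Γ₁) (h₂ : EndsIn ⟨R₂, A⟩ Γ₂) :
    Derivable (⟨R₁ ∩ R₂, A⟩ ::ₘ (Γ₁ + Γ₂)) := by
  -- An axiom consists of atoms, and no `Step` has an atom as its principal formula.
  have not_atom : ∀ {R Γ} {Γ' : Sequent L Role}, Step Derivable ⟨R, A⟩ Γ →
      ∀ R', ¬ IsAxiom (⟨R', A⟩ ::ₘ Γ') := by
    rintro R Γ Γ' h R' ⟨a, ⟨k, P, ts, rfl⟩, hΓ, -⟩
    obtain rfl := hΓ _ (Multiset.mem_cons_self _ _)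
    cases h
  rcases h₁ with h₁ | h₁ <;> rcases h₂ with h₂ | h₂
  · cases A with
    | atom P ts => cases h₁
    | neg f A =>
      cases h₁ with | neg h₁ => ?_
      cases h₂ with | neg h₂ => ?_
      refine .neg _ _ _ _ ?_
      have hf : f ⁻¹' R₁ ∪ f ⁻¹' R₂ = Set.univ := by
        rw [← Set.preimage_union, hR, Set.preimage_univ]
      exact ih A (by simp [Formula.size]) _ _ _ _ hf h₁ h₂
    | amp U A B =>
      have ihA := ih A (by simp only [Formula.size]; omega)
      have ihB := ih B (by simp only [Formula.size]; omega)
      clear ih hW₁ hW₂ not_atom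
      wlog hU : R₁ ∈ U generalizing R₁ R₂ Γ₁ Γ₂
      · rw [Set.inter_comm, add_comm]
        exact this (by rwa [Set.union_comm]) h₂ h₁
          ((mem_or_mem_of_union_eq_univ hR U).resolve_left hU)
      cases h₁ with
      | amp_neg_l hU' => exact absurd hU hU'
      | amp_neg_r hU' => exact absurd hU hU'
      | amp_pos _ hA hB =>
        cases h₂ with
        | amp_neg_l hU₂ h₂ =>
          exact .amp_neg_l _ _ _ _ _ (inter_notMem_right hU₂) (ihA _ _ _ _ hR hA h₂)
        | amp_neg_r hU₂ h₂ =>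
          exact .amp_neg_r _ _ _ _ _ (inter_notMem_right hU₂) (ihB _ _ _ _ hR hB h₂)
        | amp_pos hU₂ hA₂ hB₂ =>
          exact .amp_pos _ _ _ _ _ (Filter.inter_mem hU hU₂) (ihA _ _ _ _ hR hA hA₂)
            (ihB _ _ _ _ hR hB hB₂)
    | tensor U A B =>
      have ihA := ih A (by simp only [Formula.size]; omega)
      have ihB := ih B (by simp only [Formula.size]; omega)
      clear ih hW₁ hW₂ not_atom
      wlog hU : R₁ ∈ U generalizing R₁ R₂ Γ₁ Γ₂
      · rw [Set.inter_comm, add_comm]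
        exact this (by rwa [Set.union_comm]) h₂ h₁
          ((mem_or_mem_of_union_eq_univ hR U).resolve_left hU)
      cases h₁ with
      | tensor_neg hU' => exact absurd hU hU'
      | @tensor_pos Δ₁ Δ₂ _ _ _ _ _ hA hB =>
        cases h₂ with
        | tensor_neg hU₂ h₂ =>
          refine .tensor_neg _ _ _ _ _ (inter_notMem_right hU₂) ?_
          -- The two components are cut one after the other.
          have h := ihA _ _ _ _ hR hA h₂
          rw [Multiset.add_cons, Multiset.cons_swap] at h
          have h := ihB _ _ _ _ hR hB h
          rw [Multiset.add_cons, Multiset.cons_swap] at h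
          convert h using 3
          abel
        | tensor_pos hU₂ hA₂ hB₂ =>
          rw [add_add_add_comm]
          exact .tensor_pos _ _ _ _ _ _ (Filter.inter_mem hU hU₂) (ihA _ _ _ _ hR hA hA₂)
            (ihB _ _ _ _ hR hB hB₂)
    | bang U A =>
      rw [IFormula.isWhyNot_mk_bang, not_not] at hW₁ hW₂
      cases h₁ with
      | bang_pos _ hΓ₁ h₁ =>
        cases h₂ with
        | bang_pos _ hΓ₂ h₂ =>
          refine .bang_pos _ _ _ _ (Filter.inter_mem hW₁ hW₂) (fun F hF => ?_)
            (ih A (by simp [Formula.size]) _ _ _ _ hR h₁ h₂)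
          exact (Multiset.mem_add.1 hF).elim (hΓ₁ F) (hΓ₂ F)
        | bang_neg_weaken hU => exact absurd hW₂ hU
        | bang_neg_derelict hU => exact absurd hW₂ hU
        | bang_neg_contract hU => exact absurd hW₂ hU
      | bang_neg_weaken hU => exact absurd hW₁ hU
      | bang_neg_derelict hU => exact absurd hW₁ hU
      | bang_neg_contract hU => exact absurd hW₁ hU
    | all U A =>
      have ih' : ∀ t, CutAdmissible (A.inst t) := fun t =>
        ih _ (by simp [Formula.inst, Formula.size_subst, Formula.size])
      have ihA := ih A (by simp [Formula.size])
      clear ih hW₁ hW₂ not_atom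
      wlog hU : R₁ ∈ U generalizing R₁ R₂ Γ₁ Γ₂
      · rw [Set.inter_comm, add_comm]
        exact this (by rwa [Set.union_comm]) h₂ h₁
          ((mem_or_mem_of_union_eq_univ hR U).resolve_left hU)
      cases h₁ with
      | all_neg t hU' => exact absurd hU hU'
      | all_pos _ h₁ =>
        cases h₂ with
        | all_neg t hU₂ h₂ =>
          exact .all_neg _ _ _ _ t (inter_notMem_right hU₂) (ih' t _ _ _ _ hR (h₁.inst t) h₂)
        | all_pos hU₂ h₂ =>
          refine .all_pos _ _ _ _ (Filter.inter_mem hU hU₂) ?_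
          rw [Multiset.map_add]
          exact ihA _ _ _ _ hR h₁ h₂
  · exact absurd h₂ (not_atom h₁ _)
  · exact absurd h₁ (not_atom h₂ _)
  · exact (h₁.cut hR h₂).derivable

/-- The cut of an i-formula `[R₁]!_U B` that is introduced by promotion against one on the
negative side. Because of contraction, all copies of the latter are cut simultaneously: the
side formulas `Γ₁`, as well as the residual, admit weakening and contraction, so that one copy of
them replaces any number of copies of `[R₂]!_U B`. -/
theorem cut_of_promotion {U : Ultrafilter Role} {B : Formula L Role}
    (ih : ∀ C : Formula L Role, C.size = B.size → CutAdmissible C)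
    {R₁ R₂ : Set Role} {Γ₁ Γ₂ : Sequent L Role} (hR : R₁ ∪ R₂ = Set.univ) (hU₂ : R₂ ∉ U)
    (hΓ₁ : ∀ F ∈ Γ₁, F.IsWhyNot) (h₁ : Derivable (⟨R₁, B⟩ ::ₘ Γ₁))
    (h₂ : Derivable (⟨R₂, Formula.bang U B⟩ ::ₘ Γ₂)) :
    Derivable (⟨R₁ ∩ R₂, Formula.bang U B⟩ ::ₘ (Γ₁ + Γ₂)) := by
  have hU := inter_notMem_right (R₁ := R₁) hU₂
  let Rep : Sequent L Role → Sequent L Role → Prop := fun Φ Θ => ∃ (C : Formula L Role) (Γ : _)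
    (k : ℕ), C.size = B.size ∧ Φ = Multiset.replicate k ⟨R₂, Formula.bang U C⟩ ∧
      Θ = ⟨R₁ ∩ R₂, Formula.bang U C⟩ ::ₘ Γ ∧ (∀ F ∈ Γ, F.IsWhyNot) ∧
      Derivable (⟨R₁, C⟩ ::ₘ Γ)
  have whyNot : ∀ Φ Θ, Rep Φ Θ → ∀ F ∈ Θ, F.IsWhyNot := by
    rintro _ _ ⟨C, Γ, k, -, rfl, rfl, hΓ, -⟩ F hF
    rcases Multiset.mem_cons.1 hF with rfl | hF
    exacts [IFormula.isWhyNot_mk_bang.2 hU, hΓ F hF]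
  have := Derivable.replace (Rep := Rep) (Φ := {⟨R₂, Formula.bang U B⟩}) (Δ := Γ₂) ?_ ?_
    (fun Φ Θ h _ => whyNot Φ Θ h) ?_ ?_
    ⟨B, Γ₁, 1, rfl, rfl, rfl, hΓ₁, h₁⟩ (by rwa [Multiset.singleton_add])
  · rwa [Multiset.add_cons, add_comm] at this
  · rintro _ _ ⟨C, Γ, k, hC, rfl, rfl, hΓ, h⟩
    refine ⟨C.shift, Γ.map IFormula.shift, k, ?_, Multiset.map_replicate _ _ _,
      Multiset.map_cons _ _ _, fun F hF => ?_, ?_⟩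
    · rw [Formula.shift, Formula.size_subst, hC]
    · obtain ⟨G, hG, rfl⟩ := Multiset.mem_map.1 hF
      exact (hΓ G hG).subst _
    · have := h.subst (fun k => FirstOrder.Language.Term.var (k + 1))
      rwa [Multiset.map_cons] at this
  · intro Φ₁ Φ₂ Θ hRep
    have hW := whyNot _ _ hRep
    obtain ⟨C, Γ, k, hC, hΦ, hΘ, hΓ, h⟩ := hRep
    have h₁ : Φ₁ = _ := Multiset.eq_replicate_card.2 fun b hb =>
      Multiset.eq_of_mem_replicate (hΦ ▸ Multiset.mem_add.2 (.inl hb))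
    have h₂ : Φ₂ = _ := Multiset.eq_replicate_card.2 fun b hb =>
      Multiset.eq_of_mem_replicate (hΦ ▸ Multiset.mem_add.2 (.inr hb))
    -- Both premises receive all of `Θ`, and the two copies are contracted in the conclusion.
    exact ⟨Θ, Θ, ⟨C, Γ, _, hC, h₁, hΘ, hΓ, h⟩, ⟨C, Γ, _, hC, h₂, hΘ, hΓ, h⟩,
      fun Δ => Derivable.contract hW⟩
  · intro Φ Θ Δ hRep hax
    have hW := whyNot _ _ hRep
    obtain ⟨C, Γ, k, hC, rfl, hΘ, hΓ, h⟩ := hRep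
    cases k with
    | zero =>
      rw [Multiset.replicate_zero, zero_add] at hax
      exact hax.derivable.weaken hW
    | succ k =>
      obtain ⟨a, ⟨j, P, ts, rfl⟩, hF, -⟩ := hax
      have := hF ⟨R₂, Formula.bang U C⟩
        (Multiset.mem_add.2 (.inl (Multiset.mem_replicate.2 ⟨k.succ_ne_zero, rfl⟩)))
      cases this
  · intro F Φ Θ Δ hRep hstep
    have hW := whyNot _ _ hRep
    obtain ⟨C, Γ, k, hC, hΦ, rfl, hΓ, h⟩ := hRep
    obtain rfl : F = ⟨R₂, Formula.bang U C⟩ :=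
      Multiset.eq_of_mem_replicate (hΦ ▸ Multiset.mem_cons_self _ _)
    obtain ⟨m, rfl⟩ : ∃ m, Φ = Multiset.replicate m ⟨R₂, Formula.bang U C⟩ :=
      ⟨_, Multiset.eq_replicate_card.2 fun b hb =>
        Multiset.eq_of_mem_replicate (hΦ ▸ Multiset.mem_cons_of_mem hb)⟩
    have rep : ∀ m, Rep (Multiset.replicate m ⟨R₂, Formula.bang U C⟩)
        (⟨R₁ ∩ R₂, Formula.bang U C⟩ ::ₘ Γ) := fun m => ⟨C, Γ, m, hC, rfl, rfl, hΓ, h⟩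
    generalize hΨ : Multiset.replicate m _ + Δ = Ψ at hstep
    cases hstep with
    | bang_pos hU' => exact absurd hU' hU₂
    | bang_neg_weaken _ hD => exact hD.2 _ _ _ (rep m) hΨ.symm
    | bang_neg_derelict _ hD =>
      have hD := hD.2 _ _ (⟨R₂, C⟩ ::ₘ Δ) (rep m) (by rw [← hΨ, Multiset.add_cons])
      rw [Multiset.cons_add] at hD
      -- The new copies of the residual and of `Γ` are contracted with those already present.
      refine Derivable.contract hW ?_
      have := Derivable.bang_neg_derelict _ _ U _ hU (ih C hC _ _ _ _ hR h hD)
      convert this using 1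
      simp only [Multiset.add_cons, Multiset.cons_add]
      congr 2
      abel
    | bang_neg_contract _ hD =>
      exact hD.2 _ _ _ (rep (m + 2)) (by
        rw [← hΨ, Multiset.replicate_succ, Multiset.replicate_succ, Multiset.cons_add,
          Multiset.cons_add])

/-- Commutation of the cut with the rules of the second derivation, the first one already ending
in the introduction of its cut formula. -/
theorem cut_of_endsIn_left {A : Formula L Role}
    (ih : ∀ B : Formula L Role, B.size < A.size → CutAdmissible B)
    {R₁ R₂ : Set Role} {Γ₁ Γ₂ : Sequent L Role} (hR : R₁ ∪ R₂ = Set.univ)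
    (hW₁ : ¬ (⟨R₁, A⟩ : IFormula L Role).IsWhyNot)
    (h₁ : EndsIn ⟨R₁, A⟩ Γ₁) (h₂ : Derivable (⟨R₂, A⟩ ::ₘ Γ₂)) :
    Derivable (⟨R₁ ∩ R₂, A⟩ ::ₘ (Γ₁ + Γ₂)) := by
  by_cases hW₂ : (⟨R₂, A⟩ : IFormula L Role).IsWhyNot
  · obtain ⟨U, B, hA, hU₂⟩ := hW₂
    obtain rfl : A = Formula.bang U B := hA
    rw [IFormula.isWhyNot_mk_bang, not_not] at hW₁
    rcases h₁ with h₁ | ⟨a, ⟨k, P, ts, rfl⟩, hF, -⟩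
    · cases h₁ with
      | bang_pos _ hΓ₁ h₁ =>
        exact cut_of_promotion (fun C hC => ih C (by simp [Formula.size, hC])) hR hU₂ hΓ₁ h₁ h₂
      | bang_neg_weaken hU => exact absurd hW₁ hU
      | bang_neg_derelict hU => exact absurd hW₁ hU
      | bang_neg_contract hU => exact absurd hW₁ hU
    · cases hF _ (Multiset.mem_cons_self _ _)
  · have := Derivable.replace_single (Δ := Γ₂) (Rep := fun F Θ => ∃ (C : Formula L Role) (Γ : _),
      C.size = A.size ∧ F = ⟨R₂, C⟩ ∧ Θ = ⟨R₁ ∩ R₂, C⟩ ::ₘ Γ ∧ ¬ F.IsWhyNot ∧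
        ¬ (⟨R₁, C⟩ : IFormula L Role).IsWhyNot ∧ EndsIn ⟨R₁, C⟩ Γ) ?_ ?_ ?_
      ⟨A, Γ₁, rfl, rfl, rfl, hW₂, hW₁, h₁⟩ h₂
    · rwa [Multiset.add_cons, add_comm] at this
    · rintro _ _ ⟨C, Γ, hC, rfl, rfl, h, h', hE⟩
      exact ⟨C.shift, Γ.map IFormula.shift, (C.size_subst _).trans hC, rfl,
        Multiset.map_cons _ _ _, fun hW => h (IFormula.isWhyNot_of_subst hW),
        fun hW => h' (IFormula.isWhyNot_of_subst (F := ⟨R₁, C⟩) hW), hE.shift⟩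
    · rintro _ _ ⟨C, Γ, hC, rfl, rfl, h, -⟩
      exact h
    · rintro _ _ Δ ⟨C, Γ, hC, rfl, rfl, h, h', hE⟩ hE'
      rw [Multiset.add_cons, add_comm]
      exact cut_of_endsIn (hC ▸ ih) hR h' h hE hE'

/-- By induction on the size of `A`. Commutation starts on the side whose cut formula is not of the
form `[R]?(B)`; such a side exists because `R₁` and `R₂` cannot both be outside an ultrafilter. It
ends at promotion if `A` is exponential, so that only the other side meets contraction. -/
theorem cutAdmissible (A : Formula L Role) : CutAdmissible A := by
  induction hn : A.size using Nat.strong_induction_on generalizing A with | _ n ih => ?_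
  subst hn
  intro R₁ R₂ Γ₁ Γ₂ hR h₁ h₂
  wlog hW : ¬ (⟨R₁, A⟩ : IFormula L Role).IsWhyNot generalizing R₁ R₂ Γ₁ Γ₂
  · rw [Set.inter_comm, add_comm]
    refine this _ _ _ _ (by rwa [Set.union_comm]) h₂ h₁ fun hW₂ => hW fun hW₁ => ?_
    obtain ⟨U, B, hA, hU₁⟩ := hW₁
    obtain rfl : A = Formula.bang U B := hA
    exact (mem_or_mem_of_union_eq_univ hR U).elim hU₁ (IFormula.isWhyNot_mk_bang.1 hW₂)
  have := Derivable.replace_single (Δ := Γ₁) (Rep := fun F Θ => ∃ (C : Formula L Role) (Γ : _),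
    C.size = A.size ∧ F = ⟨R₁, C⟩ ∧ Θ = ⟨R₁ ∩ R₂, C⟩ ::ₘ Γ ∧ ¬ F.IsWhyNot ∧
      Derivable (⟨R₂, C⟩ ::ₘ Γ)) ?_ ?_ ?_
    ⟨A, Γ₂, rfl, rfl, rfl, hW, h₂⟩ h₁
  · rwa [Multiset.add_cons] at this
  · rintro _ _ ⟨C, Γ, hC, rfl, rfl, h, hD⟩
    refine ⟨C.shift, Γ.map IFormula.shift, (C.size_subst _).trans hC, rfl,
      Multiset.map_cons _ _ _, fun hW => h (IFormula.isWhyNot_of_subst hW), ?_⟩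
    have := hD.subst (fun k => FirstOrder.Language.Term.var (k + 1))
    rwa [Multiset.map_cons] at this
  · rintro _ _ ⟨C, Γ, hC, rfl, rfl, h, -⟩
    exact h
  · rintro _ _ Δ ⟨C, Γ, hC, rfl, rfl, h, hD⟩ hE
    rw [Multiset.add_cons]
    exact cut_of_endsIn_left (fun B hB => ih _ (hC ▸ hB) B rfl) hR h hE hD

/-! ### Cuts with several premises -/

theorem union_eq_univ_of_disjoint_compl {R₁ R₂ : Set Role} (h : Disjoint R₁ᶜ R₂ᶜ) :
    R₁ ∪ R₂ = Set.univ := by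
  rw [← Set.compl_empty_iff, Set.compl_union]
  exact h.inter_eq

/-- Iterating the binary cut, whose residual is again available for cutting. -/
theorem Derivable.cut_iInter {A : Formula L Role} (n : ℕ) (R : Fin (n + 1) → Set Role)
    (Γ : Fin (n + 1) → Sequent L Role) (hR : ∀ i j, i ≠ j → Disjoint (R i)ᶜ (R j)ᶜ)
    (h : ∀ i, Derivable (⟨R i, A⟩ ::ₘ Γ i)) :
    Derivable (⟨⋂ i, R i, A⟩ ::ₘ ∑ i, Γ i) := by
  induction n with
  | zero =>
    have hI : (⋂ i, R i) = R 0 := by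
      ext r
      simp
    simpa [hI] using h 0
  | succ n ih =>
    have h₁ := ih (fun i => R i.castSucc) (fun i => Γ i.castSucc)
      (fun i j hij => hR _ _ fun e => hij (Fin.castSucc_injective _ e)) fun i => h _
    rw [Fin.sum_univ_castSucc]
    have hI : (⋂ i, R i) = (⋂ i : Fin (n + 1), R i.castSucc) ∩ R (Fin.last _) := by
      ext r
      simp [Fin.forall_fin_succ']
    rw [hI]
    refine cutAdmissible A _ _ _ _ (union_eq_univ_of_disjoint_compl ?_) h₁ (h _)
    rw [Set.compl_iInter, Set.disjoint_iUnion_left]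
    exact fun i => hR _ _ (Fin.castSucc_lt_last i).ne

end Calculus

end LMRL

theorem mainTheorem1 {L : FirstOrder.Language.{u, v}} {Role : Type w}
    (A : LMRL.Formula L Role) :
    (∀ (n : ℕ), 1 ≤ n →
      ∀ (R : Fin n → Set Role) (Γ : Fin n → LMRL.Sequent L Role),
        LMRL.IsRolePartition (fun i => (R i)ᶜ) →
        (∀ i, LMRL.Derivable (⟨R i, A⟩ ::ₘ Γ i)) →
        LMRL.Derivable (∑ i, Γ i)) ∧
    (∀ (R₁ R₂ : Set Role) (Γ₁ Γ₂ : LMRL.Sequent L Role),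
        Disjoint R₁ᶜ R₂ᶜ →
        LMRL.Derivable (⟨R₁, A⟩ ::ₘ Γ₁) →
        LMRL.Derivable (⟨R₂, A⟩ ::ₘ Γ₂) →
        LMRL.Derivable (⟨R₁ ∩ R₂, A⟩ ::ₘ (Γ₁ + Γ₂))) := by
  refine ⟨fun n hn R Γ hR h => ?_, fun R₁ R₂ Γ₁ Γ₂ hR =>
    LMRL.cutAdmissible A R₁ R₂ Γ₁ Γ₂ (LMRL.union_eq_univ_of_disjoint_compl hR)⟩
  obtain ⟨m, rfl⟩ := Nat.exists_eq_add_of_le' hn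
  have hcut := LMRL.Derivable.cut_iInter m R Γ hR.1 h
  have hempty : (⋂ i, R i) = ∅ := by
    rw [← Set.compl_univ_iff, Set.compl_iInter]
    exact hR.2
  rw [hempty, ← Multiset.singleton_add] at hcut
  refine LMRL.Derivable.drop_empty (fun F hF => ?_) hcut
  rw [Multiset.mem_singleton.1 hF]
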